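/- Let $n\ge 2$. There is a constant $C=C_n<\infty$ depending only on $n$ such that the following holds. Let $1\le q\le \frac{n}{n-1}$ and $\alpha=n-q(n-1)$. For every locally finite positive Borel measure $\mu$ on $\mathbb R^n$ and every compactly supported Lipschitz function $u:\mathbb R^n\to\mathbb R$, $$\|u\|_{L^{q,1}(\mu)}\le C\int_{\mathbb R^n}|\nabla u(x)|\,\bigl(M_\alpha\mu(x)\bigr)^{1/q}\,dx ,$$ where $\|u\|_{L^{q,1}(\mu)}=q\int_0^\infty \mu(\{x:|u(x)|>t\})^{1/q}\,dt$ is the Lorentz norm, $M_\alpha\mu(x)=\sup_{r>0} r^\alpha\,\frac{\mu(B_r(x))}{|B_r(x)|}\in[0,\infty]$ is the fractional maximal function, $|B_r(x)|$ is the Lebesgue measure of the ball $B_r(x)$, and the right-hand side is understood in $[0,\infty]$ with $0\cdot\infty=0$. In particular, for $q=n'=\frac{n}{n-1}$, where $\alpha=0$ and $M_0=M$ is the Hardy--Littlewood maximal function, one has for all such $\mu$ and $u$ $$\|u\|_{L^{n'}(\mu)}\le\|u\|_{L^{n',1}(\mu)}\le C\int_{\mathbb R^n}|\nabla u(x)|\,\bigl(M\mu(x)\bigr)^{1-\frac1n}\,dx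 ,$$ which is a Lorentz-space improvement of the Gagliardo--Nirenberg--Sobolev inequality $\|u\|_{L^{n'}(\mu)}\le C\int_{\mathbb R^n}|\nabla u|\,(M\mu)^{1/n'}\,dx$ for measures. -/

import Mathlib

open MeasureTheory
open scoped ENNReal NNReal

noncomputable section

/-- The fractional maximal function
`M_α μ (x) = sup_{r > 0} r ^ α * (μ (B_r(x)) / |B_r(x)|)` of a Borel measure on `ℝⁿ`,
with values in `[0, ∞]`. -/
def fracMaximal {n : ℕ} (α : ℝ) (μ : Measure (EuclideanSpace ℝ (Fin n)))
    (x : EuclideanSpace ℝ (Fin n)) : ℝ≥0∞ :=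
  ⨆ (r : ℝ) (_ : 0 < r),
    ENNReal.ofReal (r ^ α) * (μ (Metric.ball x r) / volume (Metric.ball x r))

/-- The (centred) Hardy-Littlewood maximal function `M μ (x) = sup_{r > 0} μ (B_r(x)) / |B_r(x)|`
of a Borel measure on `ℝⁿ`, with values in `[0, ∞]`. -/
def hlMaximal {n : ℕ} (μ : Measure (EuclideanSpace ℝ (Fin n)))
    (x : EuclideanSpace ℝ (Fin n)) : ℝ≥0∞ :=
  ⨆ (r : ℝ) (_ : 0 < r), μ (Metric.ball x r) / volume (Metric.ball x r)

/-- The Lorentz quasi-norm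
`‖f‖_{L^{p,s}(μ)} = (p * ∫₀^∞ t ^ (s - 1) * μ {|f| > t} ^ (s / p) dt) ^ (1 / s)`
for finite exponents `1 ≤ p, s < ∞`, with values in `[0, ∞]`. -/
def eLorentzNorm {X : Type*} [MeasurableSpace X] (f : X → ℝ) (p s : ℝ) (μ : Measure X) : ℝ≥0∞ :=
  (ENNReal.ofReal p *
    ∫⁻ t in Set.Ioi (0 : ℝ), ENNReal.ofReal (t ^ (s - 1)) * μ {x | t < |f x|} ^ (s / p)) ^ (1 / s)

end

/-! The proof is a boxing inequality for superlevel sets, with thin truncations of `|u|` in place of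
perimeters and the coarea formula.

Fix `t ≥ 0`, put `A = {|u| > t}`, and let `w` be the truncation rising from 0 to 1 on the strip `t <
|u| < t + h`. A point with `|u| > t + δ` is the centre of a ball inside `A` whose radius depends
only on `δ` and the Lipschitz constant. Doubling the radius until `A` fills at most half of the ball
gives `B_r` in which both `A` and its complement have a definite share. For small `h` the strip is
negligible in `B_r`, so the Poincaré inequality for `w` gives `r ^ (n - 1) ≲ ∫_{B_r} |∇w|`
(`measure_ball_le_lintegral_fderiv_levelTruncation`).

Since `n - α = q (n - 1)`, every `y ∈ B_r` satisfies `μ(B_{5r}) ^ (1/q) ≲ r ^ (n - 1) M_α μ(y) ^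
(1/q)`. Hence `μ(B_{5r}) ^ (1/q) ≲ ∫_{B_r} |∇w| (M_α μ) ^ (1/q)`. A Vitali selection and the
subadditivity of `s ↦ s ^ (1/q)` sum this over disjoint balls
(`rpow_measure_le_lintegral_fderiv_levelTruncation`).

Now `|∇w| ≤ h⁻¹ |∇u|` on the strip and `∇w = 0` elsewhere. Letting `h → 0`, then `δ → 0`, and
integrating in `t` with Fatou and Tonelli gives the theorem, because each point lies in the strip
for a set of `t` of length at most `h`. -/

theorem lintegral_const_mul_lintegral_rotate {α β γ : Type*} [MeasurableSpace α]
    [MeasurableSpace β] [MeasurableSpace γ] {μ : Measure α} {ν : Measure β} {κ : Measure γ}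
    [SFinite μ] [SFinite ν] [SFinite κ] {F : α → β → γ → ℝ≥0∞}
    (hF : Measurable fun p : (α × β) × γ => F p.1.1 p.1.2 p.2) (D : ℝ≥0∞) :
    ∫⁻ x, ∫⁻ y, D * ∫⁻ s, F x y s ∂κ ∂ν ∂μ = D * ∫⁻ s, ∫⁻ x, ∫⁻ y, F x y s ∂ν ∂μ ∂κ := by
  have h0 : Measurable fun p : α × β => ∫⁻ s, F p.1 p.2 s ∂κ :=
    Measurable.lintegral_prod_right' hF
  have h1 : ∀ x, Measurable fun y => ∫⁻ s, F x y s ∂κ := fun x =>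
    h0.comp measurable_prodMk_left
  have h2 : Measurable fun x => ∫⁻ y, ∫⁻ s, F x y s ∂κ ∂ν := Measurable.lintegral_prod_right' h0
  simp_rw [lintegral_const_mul _ (h1 _)]
  rw [lintegral_const_mul _ h2]
  congr 1
  have h3 : ∀ x, ∫⁻ y, ∫⁻ s, F x y s ∂κ ∂ν = ∫⁻ s, ∫⁻ y, F x y s ∂ν ∂κ := fun x =>
    lintegral_lintegral_swap (hF.comp
      (by fun_prop : Measurable fun p : β × γ => ((x, p.1), p.2))).aemeasurable
  simp_rw [h3]
  have h4 : Measurable fun p : (α × γ) × β => F p.1.1 p.2 p.1.2 :=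
    hF.comp (by fun_prop : Measurable fun p : (α × γ) × β => ((p.1.1, p.2), p.1.2))
  exact lintegral_lintegral_swap (Measurable.lintegral_prod_right' h4).aemeasurable

/-! ### Poincaré inequality on convex sets, by integration along segments -/

section Poincare

variable {E : Type*} [NormedAddCommGroup E] [NormedSpace ℝ E] [FiniteDimensional ℝ E]
  [MeasurableSpace E] [BorelSpace E] {μ : Measure E} [μ.IsAddHaarMeasure]

theorem lintegral_comp_smul_add_le {g : E → ℝ≥0∞} (hg : Measurable g) {c : ℝ} (hc : 1 / 2 ≤ c)
    (b : E) :
    ∫⁻ x, g (c • x + b) ∂μ ≤ 2 ^ Module.finrank ℝ E * ∫⁻ x, g x ∂μ := by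
  have hc0 : c ≠ 0 := by positivity
  have h1 : ∫⁻ x, g (c • x + b) ∂μ = ∫⁻ x, g (x + b) ∂(Measure.map (c • ·) μ) :=
    (lintegral_map (f := fun x => g (x + b)) (by fun_prop) (by fun_prop)).symm
  rw [h1, Measure.map_addHaar_smul μ hc0, lintegral_smul_measure, lintegral_add_right_eq_self]
  rw [smul_eq_mul]
  gcongr
  rw [ENNReal.ofReal_le_iff_le_toReal (by finiteness)]
  have : c⁻¹ ≤ 2 := by
    rw [inv_le_comm₀ (by positivity) (by positivity)]; linarith
  rw [abs_of_nonneg (by positivity), ← inv_pow]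
  simp only [ENNReal.toReal_pow, ENNReal.toReal_ofNat]
  gcongr

theorem setLIntegral_comp_segment_le {g : E → ℝ≥0∞} (hg : Measurable g) {B : Set E}
    (hB : Convex ℝ B) (hBm : MeasurableSet B) {c t : ℝ} (hc : 1 / 2 ≤ c) (ht : 0 ≤ t)
    (hct : c + t = 1) {y : E} (hy : y ∈ B) :
    ∫⁻ x in B, g (c • x + t • y) ∂μ ≤ 2 ^ Module.finrank ℝ E * ∫⁻ x in B, g x ∂μ := by
  rw [← lintegral_indicator hBm, ← lintegral_indicator hBm]
  refine le_trans (lintegral_mono fun x => ?_)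
    (lintegral_comp_smul_add_le (hg.indicator hBm) hc (t • y))
  by_cases hx : x ∈ B
  · rw [Set.indicator_of_mem hx, Set.indicator_of_mem (hB hx hy (by linarith) ht hct)]
  · simp [Set.indicator_of_notMem hx]

/-- One of the weights `1 - s`, `s` is at least `1/2`. Changing variables in the point carrying that
weight costs a Jacobian of at most `2 ^ d`, uniformly in `s`. -/
theorem setLIntegral_setLIntegral_comp_segment_le {g : E → ℝ≥0∞} (hg : Measurable g) {B : Set E}
    (hB : Convex ℝ B) (hBm : MeasurableSet B) {s : ℝ} (hs : s ∈ Set.Ioo (0 : ℝ) 1) :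
    ∫⁻ x in B, ∫⁻ y in B, g ((1 - s) • x + s • y) ∂μ ∂μ ≤
      2 ^ Module.finrank ℝ E * (∫⁻ x in B, g x ∂μ) * μ B := by
  obtain h | h := le_total s (1 / 2)
  · rw [lintegral_lintegral_swap (Measurable.aemeasurable (by unfold Function.uncurry; fun_prop)),
      ← setLIntegral_const]
    exact setLIntegral_mono measurable_const fun y hy =>
      setLIntegral_comp_segment_le hg hB hBm (by linarith) hs.1.le (by ring) hy
  · rw [← setLIntegral_const]
    refine setLIntegral_mono measurable_const fun x hx => ?_
    simp_rw [add_comm ((1 - s) • x)]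
    exact setLIntegral_comp_segment_le hg hB hBm (by linarith) (by linarith [hs.2]) (by ring) hx

/-- A Lipschitz function restricted to a segment is absolutely continuous, so the fundamental
theorem of calculus holds. Almost everywhere differentiability of `f` along the segment suffices for
the chain rule under the integral. -/
theorem enorm_sub_le_lintegral_fderiv {F : Type*} [NormedAddCommGroup F] [NormedSpace ℝ F]
    {f : F → ℝ} {K : ℝ≥0} (hf : LipschitzWith K f) (x y : F)
    (hd : ∀ᵐ s ∂(volume.restrict (Set.Ioo (0 : ℝ) 1)),
      DifferentiableAt ℝ f ((1 - s) • x + s • y)) :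
    ‖f x - f y‖ₑ ≤
      ‖x - y‖ₑ * ∫⁻ s in Set.Ioo (0 : ℝ) 1, ‖fderiv ℝ f ((1 - s) • x + s • y)‖ₑ := by
  set γ : ℝ → F := fun s => (1 - s) • x + s • y with hγ
  have hγd : ∀ s, HasDerivAt γ (y - x) s := fun s => by
    have h1 : HasDerivAt (fun s : ℝ => (1 - s) • x) ((-1 : ℝ) • x) s :=
      ((hasDerivAt_id s).const_sub 1).smul_const x
    have h2 : HasDerivAt (fun s : ℝ => s • y) ((1 : ℝ) • y) s := (hasDerivAt_id s).smul_const y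
    convert! h1.add h2 using 1
    module
  have hγL : LipschitzWith ‖y - x‖₊ γ :=
    lipschitzWith_of_nnnorm_deriv_le (fun s => (hγd s).differentiableAt)
      fun s => by rw [(hγd s).deriv]
  have hac := ((hf.comp hγL).lipschitzOnWith (s := Set.uIcc (0 : ℝ) 1)).absolutelyContinuousOnInterval
  have hint := hac.integral_deriv_eq_sub
  have h0 : γ 0 = x := by simp [hγ]
  have h1 : γ 1 = y := by simp [hγ]
  simp only [Function.comp_apply, h0, h1] at hint
  rw [← enorm_neg, neg_sub, ← hint, intervalIntegral.integral_of_le zero_le_one,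
    integral_Ioc_eq_integral_Ioo]
  refine (enorm_integral_le_lintegral_enorm _).trans ?_
  rw [← lintegral_const_mul' _ _ (by finiteness)]
  refine lintegral_mono_ae ?_
  filter_upwards [hd] with s hs
  rw [(hs.hasFDerivAt.comp_hasDerivAt s (hγd s)).deriv, mul_comm, ← enorm_neg (x - y), neg_sub]
  exact ContinuousLinearMap.le_opENorm _ _

/-- Rademacher's theorem gives a null set of bad points. For fixed `s > 0` its preimage under `y ↦
(1 - s) x + s y` is null, and Fubini exchanges the order of `s` and `y`. -/
theorem LipschitzWith.ae_ae_differentiableAt_segment {f : E → ℝ} {K : ℝ≥0}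
    (hf : LipschitzWith K f) (x : E) :
    ∀ᵐ y ∂μ, ∀ᵐ s ∂(volume.restrict (Set.Ioo (0 : ℝ) 1)),
      DifferentiableAt ℝ f ((1 - s) • x + s • y) := by
  have hm : Measurable fun p : E × ℝ => (1 - p.2) • x + p.2 • p.1 := by fun_prop
  refine (Measure.ae_ae_comm (p := fun (y : E) (s : ℝ) =>
    DifferentiableAt ℝ f ((1 - s) • x + s • y))
    (hm (measurableSet_of_differentiableAt ℝ f))).2 ?_
  filter_upwards [ae_restrict_mem measurableSet_Ioo] with s hs
  have hq : Measure.QuasiMeasurePreserving (fun y : E => (1 - s) • x + s • y) μ μ :=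
    (measurePreserving_add_left μ ((1 - s) • x)).quasiMeasurePreserving.comp
      (Measure.quasiMeasurePreserving_smul μ hs.1.ne')
  exact hq.ae hf.ae_differentiableAt

/-- A Poincaré inequality on convex sets. -/
theorem LipschitzWith.lintegral_lintegral_enorm_sub_le {f : E → ℝ} {K : ℝ≥0}
    (hf : LipschitzWith K f) {B : Set E} (hB : Convex ℝ B) (hBm : MeasurableSet B) {D : ℝ≥0∞}
    (hD : ∀ x ∈ B, ∀ y ∈ B, ‖x - y‖ₑ ≤ D) :
    ∫⁻ x in B, ∫⁻ y in B, ‖f x - f y‖ₑ ∂μ ∂μ ≤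
      D * (2 ^ Module.finrank ℝ E * (∫⁻ x in B, ‖fderiv ℝ f x‖ₑ ∂μ) * μ B) := by
  have hg : Measurable fun x => ‖fderiv ℝ f x‖ₑ := (measurable_fderiv ℝ f).enorm
  have hγ : Measurable fun p : (E × E) × ℝ => ‖fderiv ℝ f ((1 - p.2) • p.1.1 + p.2 • p.1.2)‖ₑ :=
    hg.comp (by fun_prop)
  calc ∫⁻ x in B, ∫⁻ y in B, ‖f x - f y‖ₑ ∂μ ∂μ
      ≤ ∫⁻ x in B, ∫⁻ y in B, D * ∫⁻ s in Set.Ioo (0 : ℝ) 1,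
          ‖fderiv ℝ f ((1 - s) • x + s • y)‖ₑ ∂volume ∂μ ∂μ := by
        refine lintegral_mono_ae ?_
        filter_upwards [ae_restrict_mem hBm] with x hx
        refine lintegral_mono_ae ?_
        filter_upwards [ae_restrict_mem hBm,
          ae_restrict_of_ae (hf.ae_ae_differentiableAt_segment (μ := μ) x)] with y hy hd
        exact (enorm_sub_le_lintegral_fderiv hf x y hd).trans (by gcongr; exact hD x hx y hy)
    _ = D * ∫⁻ s in Set.Ioo (0 : ℝ) 1, ∫⁻ x in B, ∫⁻ y in B,
          ‖fderiv ℝ f ((1 - s) • x + s • y)‖ₑ ∂μ ∂μ ∂volume :=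
        lintegral_const_mul_lintegral_rotate
          (F := fun x y s => ‖fderiv ℝ f ((1 - s) • x + s • y)‖ₑ) hγ D
    _ ≤ D * ∫⁻ s in Set.Ioo (0 : ℝ) 1,
          2 ^ Module.finrank ℝ E * (∫⁻ x in B, ‖fderiv ℝ f x‖ₑ ∂μ) * μ B ∂volume := by
        gcongr D * ?_
        exact setLIntegral_mono measurable_const fun s hs =>
          setLIntegral_setLIntegral_comp_segment_le hg hB hBm hs
    _ = _ := by simp

/-- Two-set form of the Poincaré inequality: the double integral of `|f x - f y|` over `B × B` is at
least its part over `T × S`, where the integrand is 1. -/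
theorem LipschitzWith.measure_mul_measure_le {f : E → ℝ} {K : ℝ≥0}
    (hf : LipschitzWith K f) {B S T : Set E} (hB : Convex ℝ B) (hBm : MeasurableSet B) {D : ℝ≥0∞}
    (hD : ∀ x ∈ B, ∀ y ∈ B, ‖x - y‖ₑ ≤ D) (hS : S ⊆ B) (hT : T ⊆ B)
    (hSm : MeasurableSet S) (hTm : MeasurableSet T)
    (h0 : ∀ x ∈ S, f x = 0) (h1 : ∀ x ∈ T, f x = 1) :
    μ T * μ S ≤ D * (2 ^ Module.finrank ℝ E * (∫⁻ x in B, ‖fderiv ℝ f x‖ₑ ∂μ) * μ B) := by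
  refine le_trans ?_ (hf.lintegral_lintegral_enorm_sub_le hB hBm hD)
  calc μ T * μ S = ∫⁻ x in T, ∫⁻ y in S, 1 ∂μ ∂μ := by simp [mul_comm]
    _ ≤ ∫⁻ x in T, ∫⁻ y in S, ‖f x - f y‖ₑ ∂μ ∂μ := by
        refine setLIntegral_mono' hTm fun x hx => setLIntegral_mono' hSm fun y hy => ?_
        simp [h0 y hy, h1 x hx]
    _ ≤ ∫⁻ x in B, ∫⁻ y in B, ‖f x - f y‖ₑ ∂μ ∂μ :=
        (lintegral_mono fun x => lintegral_mono_set hS).trans (lintegral_mono_set hT)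

end Poincare

/-! ### Truncation of `|u|` to a thin strip of levels -/

section Truncation

variable {E : Type*}

/-- The truncation of `|u|` between the levels `t` and `t + h`, normalised to take values in
`[0, 1]`. -/
noncomputable def levelTruncation (u : E → ℝ) (t h : ℝ) (x : E) : ℝ :=
  min (max (h⁻¹ * (|u x| - t)) 0) 1

theorem levelTruncation_eq_zero {u : E → ℝ} {t h : ℝ} (hh : 0 < h) {x : E} (hx : |u x| ≤ t) :
    levelTruncation u t h x = 0 := by
  have : h⁻¹ * (|u x| - t) ≤ 0 := mul_nonpos_of_nonneg_of_nonpos (by positivity) (by linarith)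
  simp [levelTruncation, max_eq_right this]

theorem levelTruncation_eq_one {u : E → ℝ} {t h : ℝ} (hh : 0 < h) {x : E} (hx : t + h ≤ |u x|) :
    levelTruncation u t h x = 1 := by
  have : 1 ≤ h⁻¹ * (|u x| - t) := by
    rw [← div_eq_inv_mul, le_div_iff₀ hh]; linarith
  simp [levelTruncation, this]

theorem LipschitzWith.levelTruncation [NormedAddCommGroup E] {u : E → ℝ} {K : ℝ≥0} (hu : LipschitzWith K u) (t h : ℝ) :
    ∃ K' : ℝ≥0, LipschitzWith K' (levelTruncation u t h) := by
  have h1 : LipschitzWith (1 * K) (fun x => |u x|) := lipschitzWith_one_norm.comp hu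
  have h2 := (lipschitzWith_smul (β := ℝ) h⁻¹).comp (h1.sub (LipschitzWith.const t))
  exact ⟨_, (h2.max_const 0).min_const 1⟩

theorem enorm_fderiv_levelTruncation_le [NormedAddCommGroup E] [NormedSpace ℝ E]
    {u : E → ℝ} (hu : Continuous u) {t h : ℝ} (ht : 0 ≤ t)
    (hh : 0 < h) (x : E) :
    ‖fderiv ℝ (levelTruncation u t h) x‖ₑ ≤
      {x | t < |u x| ∧ |u x| < t + h}.indicator
        (fun x => ENNReal.ofReal h⁻¹ * ‖fderiv ℝ u x‖ₑ) x := by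
  -- Off the open strip the truncation attains its global minimum 0 or maximum 1, so `fderiv`
  -- vanishes there. This covers the boundary levels, where the truncation need not be
  -- differentiable.
  obtain hx | hx := le_or_gt |u x| t
  · have : IsLocalMin (levelTruncation u t h) x := Filter.Eventually.of_forall fun y => by
      rw [levelTruncation_eq_zero hh hx]; simp [levelTruncation]
    rw [this.fderiv_eq_zero]
    exact (enorm_zero (E := E →L[ℝ] ℝ)).trans_le zero_le
  obtain hx' | hx' := le_or_gt (t + h) |u x|
  · have : IsLocalMax (levelTruncation u t h) x := Filter.Eventually.of_forall fun y => by
      rw [levelTruncation_eq_one hh hx']; simp [levelTruncation]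
    rw [this.fderiv_eq_zero]
    exact (enorm_zero (E := E →L[ℝ] ℝ)).trans_le zero_le
  have hmem : x ∈ {x | t < |u x| ∧ |u x| < t + h} := ⟨hx, hx'⟩
  rw [Set.indicator_of_mem hmem]
  have hopen : IsOpen {x | t < |u x| ∧ |u x| < t + h} :=
    (isOpen_lt continuous_const hu.abs).inter (isOpen_lt hu.abs continuous_const)
  have key : ∀ y ∈ {x | t < |u x| ∧ |u x| < t + h},
      levelTruncation u t h y = h⁻¹ * (|u y| - t) := fun y hy => by
    have h1 : 0 ≤ h⁻¹ * (|u y| - t) := mul_nonneg (by positivity) (by linarith [hy.1])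
    have h2 : h⁻¹ * (|u y| - t) ≤ 1 := by
      rw [← div_eq_inv_mul, div_le_one hh]; linarith [hy.2]
    simp [levelTruncation, h1, h2]
  have hc : ENNReal.ofReal h⁻¹ = ‖h⁻¹‖ₑ := (Real.enorm_of_nonneg (by positivity)).symm
  -- Near a point of the strip `u` has constant sign, since `|u x| > t ≥ 0`; the truncation is then
  -- locally affine in `u`. The `fderiv` rules used need no differentiability of `u`: the default
  -- value 0 appears on both sides.
  obtain hpos | hneg := lt_or_ge 0 (u x)
  · have heq : levelTruncation u t h =ᶠ[nhds x] h⁻¹ • fun y => u y - t := by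
      filter_upwards [hopen.mem_nhds hmem, hu.continuousAt.eventually (lt_mem_nhds hpos)]
        with y hy hy'
      rw [key y hy, abs_of_pos hy', Pi.smul_apply, smul_eq_mul]
    rw [heq.fderiv_eq, fderiv_const_smul_field, Pi.smul_apply, fderiv_sub_const, enorm_smul, hc]
  · have hneg' : u x < 0 := lt_of_le_of_ne hneg fun h0 => by
      rw [h0, abs_zero] at hx; linarith
    have heq : levelTruncation u t h =ᶠ[nhds x] h⁻¹ • fun y => -u y - t := by
      filter_upwards [hopen.mem_nhds hmem, hu.continuousAt.eventually (gt_mem_nhds hneg')]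
        with y hy hy'
      rw [key y hy, abs_of_neg hy', Pi.smul_apply, smul_eq_mul]
    rw [heq.fderiv_eq, fderiv_const_smul_field, Pi.smul_apply, fderiv_sub_const, fderiv_fun_neg, enorm_smul,
      enorm_neg, hc]

end Truncation

/-! ### Balls shared between a superlevel set and its complement -/

section Radius

variable {E : Type*} [NormedAddCommGroup E] [NormedSpace ℝ E] [FiniteDimensional ℝ E]
  [MeasurableSpace E] [BorelSpace E] {μ : Measure E} [μ.IsAddHaarMeasure]

/-- Take the first radius `2 ^ k * ρ` at which `A` fills at most half of the ball. At `k = 0` it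
fills the whole ball, so `k > 0`. At half the radius `A` filled more than half, and doubling
multiplies the volume by `2 ^ d`. The bound `2 ^ N * ρ` does not depend on `x`, as the Vitali
covering requires. -/
theorem exists_radius_measure_inter_ball [Nontrivial E] {A : Set E} {ρ : ℝ} (hρ : 0 < ρ) {N : ℕ}
    (hN : 2 * μ A ≤ μ (Metric.ball 0 (2 ^ N * ρ))) {x : E} (hx : Metric.ball x ρ ⊆ A) :
    ∃ r, ρ ≤ r ∧ r ≤ 2 ^ N * ρ ∧
      2 * μ (A ∩ Metric.ball x r) ≤ μ (Metric.ball x r) ∧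
      μ (Metric.ball x r) ≤ 2 ^ (Module.finrank ℝ E + 1) * μ (A ∩ Metric.ball x r) := by
  classical
  have hex : ∃ k : ℕ, 2 * μ (A ∩ Metric.ball x (2 ^ k * ρ)) ≤ μ (Metric.ball x (2 ^ k * ρ)) := by
    refine ⟨N, le_trans (by gcongr; exact Set.inter_subset_left) (hN.trans_eq ?_)⟩
    exact (Measure.addHaar_ball_center μ x _).symm
  have hle : Nat.find hex ≤ N := Nat.find_min' hex
    (le_trans (by gcongr; exact Set.inter_subset_left)
      (hN.trans_eq (Measure.addHaar_ball_center μ x _).symm))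
  have hspec := Nat.find_spec hex
  have hmin := fun m => Nat.find_min hex (m := m)
  generalize Nat.find hex = k at hle hspec hmin
  refine ⟨2 ^ k * ρ, le_mul_of_one_le_left hρ.le (one_le_pow₀ one_le_two), ?_, hspec, ?_⟩
  · gcongr; exact one_le_two
  obtain _ | k := k
  · exfalso
    rw [pow_zero, one_mul, Set.inter_eq_right.2 hx, two_mul] at hspec
    have h0 : μ (Metric.ball x ρ) ≠ 0 := (Metric.measure_ball_pos μ x hρ).ne'
    have h1 : μ (Metric.ball x ρ) ≠ ∞ := measure_ball_lt_top.ne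
    exact absurd hspec (not_le.2 (ENNReal.lt_add_right h1 h0))
  · have h := (not_le.1 (hmin k k.lt_succ_self)).le
    have hball : μ (Metric.ball x (2 ^ (k + 1) * ρ)) =
        2 ^ Module.finrank ℝ E * μ (Metric.ball x (2 ^ k * ρ)) := by
      rw [pow_succ', mul_assoc, Measure.addHaar_ball_mul μ x zero_le_two,
        ← Measure.addHaar_ball_center μ x (2 ^ k * ρ), ENNReal.ofReal_pow zero_le_two,
        ENNReal.ofReal_ofNat]
    rw [hball, pow_succ, mul_assoc]
    gcongr
    refine h.trans ?_
    gcongr 2 * μ (A ∩ Metric.ball x ?_)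
    gcongr
    · exact one_le_two
    · exact k.le_succ

/-- If a Lipschitz function is `0` on a large part of a ball and `1` on a large part of the same
ball, its gradient has large mass there. -/
theorem measure_ball_le_lintegral_fderiv_levelTruncation {u : E → ℝ} {K : ℝ≥0}
    (hu : LipschitzWith K u) {t h : ℝ} (hh : 0 < h) {x : E} {r : ℝ} (hr : 0 < r)
    (hZ : 2 ^ (Module.finrank ℝ E + 2) * μ {x | t < |u x| ∧ |u x| < t + h} ≤
      μ (Metric.ball x r))
    (h1 : 2 * μ ({x | t < |u x|} ∩ Metric.ball x r) ≤ μ (Metric.ball x r))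
    (h2 : μ (Metric.ball x r) ≤
      2 ^ (Module.finrank ℝ E + 1) * μ ({x | t < |u x|} ∩ Metric.ball x r)) :
    μ (Metric.ball x r) ≤ 2 ^ (2 * Module.finrank ℝ E + 4) * ENNReal.ofReal r *
      ∫⁻ y in Metric.ball x r, ‖fderiv ℝ (levelTruncation u t h) y‖ₑ ∂μ := by
  set d := Module.finrank ℝ E
  set B := Metric.ball x r with hBdef
  set A := {x | t < |u x|} with hA
  set Z := {x | t < |u x| ∧ |u x| < t + h} with hZdef
  set G := ∫⁻ y in B, ‖fderiv ℝ (levelTruncation u t h) y‖ₑ ∂μ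
  have hAm : MeasurableSet A := measurableSet_lt measurable_const hu.continuous.abs.measurable
  have hTm : MeasurableSet {x | t + h ≤ |u x|} :=
    measurableSet_le measurable_const hu.continuous.abs.measurable
  have hV0 : μ B ≠ 0 := (Metric.measure_ball_pos μ x hr).ne'
  have hV1 : μ B ≠ ∞ := measure_ball_lt_top.ne
  obtain ⟨K', hK'⟩ := hu.levelTruncation t h
  have hD : ∀ y ∈ B, ∀ z ∈ B, ‖y - z‖ₑ ≤ 2 * ENNReal.ofReal r := fun y hy z hz => by
    rw [← ofReal_norm, ← dist_eq_norm, ← ENNReal.ofReal_ofNat, ← ENNReal.ofReal_mul zero_le_two]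
    apply ENNReal.ofReal_le_ofReal
    linarith [dist_triangle_right y z x, Metric.mem_ball.1 hy, Metric.mem_ball.1 hz]
  have hP := hK'.measure_mul_measure_le (μ := μ) (convex_ball x r) measurableSet_ball hD
    (S := B \ A) (T := B ∩ {x | t + h ≤ |u x|}) Set.sdiff_subset Set.inter_subset_left
    (measurableSet_ball.diff hAm) (measurableSet_ball.inter hTm)
    (fun y hy => levelTruncation_eq_zero hh (not_lt.1 hy.2))
    (fun y hy => levelTruncation_eq_one hh hy.2)
  set T := B ∩ {x | t + h ≤ |u x|}
  have hS : μ B ≤ 2 * μ (B \ A) := by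
    have e := measure_inter_add_sdiff (μ := μ) B hAm
    rw [Set.inter_comm] at e
    have hfin : μ (A ∩ B) ≠ ∞ := measure_ne_top_of_subset Set.inter_subset_right hV1
    rw [← e, two_mul] at h1
    have := (ENNReal.add_le_add_iff_left hfin).1 h1
    rw [← e, two_mul]; gcongr
  -- `A` occupies at least the fraction `2 ^ -(d + 1)` of `B` and the strip at most half of that, so
  -- `T`, where the truncation is 1, keeps `2 ^ -(d + 2)`.
  have hT : μ B ≤ 2 ^ (d + 2) * μ T := by
    have hsub : A ∩ B ⊆ T ∪ Z := fun y hy => by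
      by_cases h' : t + h ≤ |u y|
      · exact Or.inl ⟨hy.2, h'⟩
      · exact Or.inr ⟨hy.1, not_le.1 h'⟩
    have h3 : μ (A ∩ B) ≤ μ T + μ Z := (measure_mono hsub).trans (measure_union_le _ _)
    have h4 : 2 * μ B ≤ 2 ^ (d + 2) * μ T + μ B := calc
      2 * μ B ≤ 2 * (2 ^ (d + 1) * (μ T + μ Z)) := by gcongr; exact h2.trans (by gcongr)
      _ = 2 ^ (d + 2) * μ T + 2 ^ (d + 2) * μ Z := by ring
      _ ≤ _ := by gcongr
    rw [two_mul] at h4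
    exact (ENNReal.add_le_add_iff_right hV1).1 h4
  -- The two-set inequality is quadratic in the volume on the left and carries one factor `μ B` on
  -- the right, which cancels.
  have hfinal : μ B * μ B ≤ (2 ^ (2 * d + 4) * ENNReal.ofReal r * G) * μ B := calc
    μ B * μ B ≤ (2 ^ (d + 2) * μ T) * (2 * μ (B \ A)) := by gcongr
    _ = 2 ^ (d + 3) * (μ T * μ (B \ A)) := by ring
    _ ≤ 2 ^ (d + 3) * (2 * ENNReal.ofReal r * (2 ^ d * G * μ B)) := by gcongr
    _ = _ := by ring
  exact (ENNReal.mul_le_mul_iff_left hV0 hV1).1 hfinal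

end Radius

theorem ENNReal.tsum_rpow_le_tsum_rpow {ι : Type*} (f : ι → ℝ≥0∞) {q : ℝ} (hq : 1 ≤ q) :
    (∑' i, f i) ^ (1 / q) ≤ ∑' i, f i ^ (1 / q) := by
  have hq0 : 0 < q := by linarith
  have hfin : ∀ s : Finset ι, (∑ i ∈ s, f i) ^ (1 / q) ≤ ∑ i ∈ s, f i ^ (1 / q) := fun s => by
    classical
    induction s using Finset.induction_on with
    | empty => simp [hq0]
    | insert a s ha ih =>
      rw [Finset.sum_insert ha, Finset.sum_insert ha]
      refine (ENNReal.rpow_add_le_add_rpow _ _ (by positivity) ?_).trans (by gcongr)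
      rw [div_le_one hq0]; exact hq
  rw [one_div, ENNReal.rpow_inv_le_iff hq0, ENNReal.tsum_eq_iSup_sum]
  refine iSup_le fun s => ?_
  rw [← ENNReal.rpow_inv_le_iff hq0, ← one_div]
  exact (hfin s).trans (ENNReal.sum_le_tsum s)

/-! ### The fractional maximal function and the boxing inequality at one level -/

section Maximal

variable {n : ℕ}

local notation "Eu" => EuclideanSpace ℝ (Fin n)

theorem fracMaximal_zero (μ : Measure Eu) (x : Eu) : fracMaximal 0 μ x = hlMaximal μ x := by
  simp [fracMaximal, hlMaximal]

/-- An open ball is the increasing union of smaller concentric balls, so a strict lower bound at `x`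
already holds for a slightly smaller ball, which is contained in `B_r(y)` for `y` near `x`. This
supplies measurability. -/
theorem lowerSemicontinuous_fracMaximal (α : ℝ) (μ : Measure Eu) :
    LowerSemicontinuous (fracMaximal α μ) := by
  refine lowerSemicontinuous_biSup fun r hr x c hc => ?_
  have hU : Metric.ball x r = ⋃ k : ℕ, Metric.ball x (r - 1 / ((k : ℝ) + 1)) := by
    ext y
    simp only [Metric.mem_ball, Set.mem_iUnion]
    constructor
    · intro hy
      obtain ⟨k, hk⟩ := exists_nat_one_div_lt (sub_pos.2 hy)
      exact ⟨k, by linarith⟩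
    · rintro ⟨k, hk⟩
      have : 0 < 1 / ((k : ℝ) + 1) := by positivity
      linarith
  have hmono : Monotone fun k : ℕ => Metric.ball x (r - 1 / ((k : ℝ) + 1)) := fun i j hij =>
    Metric.ball_subset_ball (sub_le_sub_left (Nat.one_div_le_one_div hij) r)
  simp only [gt_iff_lt] at hc ⊢
  rw [Measure.addHaar_ball_center volume, hU, hmono.measure_iUnion, ENNReal.iSup_div,
    ENNReal.mul_iSup, lt_iSup_iff] at hc
  obtain ⟨k, hk⟩ := hc
  have hk0 : 0 < 1 / ((k : ℝ) + 1) := by positivity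
  filter_upwards [Metric.ball_mem_nhds x hk0] with y hy
  rw [Measure.addHaar_ball_center volume]
  refine hk.trans_le ?_
  gcongr ENNReal.ofReal (r ^ α) * (μ ?_ / _)
  refine Metric.ball_subset_ball' ?_
  rw [Metric.mem_ball, dist_comm] at hy
  linarith

/-- The constant in the local estimate on a single ball. -/
noncomputable def ballConstant (n : ℕ) : ℝ≥0∞ :=
  (1 + (volume (Metric.ball (0 : EuclideanSpace ℝ (Fin n)) 1))⁻¹) * (7 ^ n * 2 ^ (2 * n + 4))

theorem ballConstant_ne_top (n : ℕ) : ballConstant n ≠ ∞ := by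
  have h : volume (Metric.ball (0 : EuclideanSpace ℝ (Fin n)) 1) ≠ 0 :=
    (Metric.measure_ball_pos volume (0 : EuclideanSpace ℝ (Fin n)) one_pos).ne'
  have h' : (volume (Metric.ball (0 : EuclideanSpace ℝ (Fin n)) 1))⁻¹ ≠ ∞ := ENNReal.inv_ne_top.2 h
  exact ENNReal.mul_ne_top (ENNReal.add_ne_top.2 ⟨ENNReal.one_ne_top, h'⟩) (by finiteness)

/-- The maximal function at `y` is tested on the ball of radius `7 r`. The exponent `α` makes `n - α
= q (n - 1)`, so the `q`-th root leaves `r ^ (n - 1)` for every `q`, and this is what `hG` bounds by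
`G`. -/
theorem rpow_measure_closedBall_le {q : ℝ} (hq : 1 ≤ q) (μ : Measure Eu) {x y : Eu} {r : ℝ}
    (hr : 0 < r) (hy : y ∈ Metric.closedBall x r) {G : ℝ≥0∞}
    (hG : volume (Metric.ball x r) ≤ 2 ^ (2 * n + 4) * ENNReal.ofReal r * G) :
    μ (Metric.closedBall x (5 * r)) ^ (1 / q) ≤
      ballConstant n * G * fracMaximal ((n : ℝ) - q * ((n : ℝ) - 1)) μ y ^ (1 / q) := by
  have hq0 : 0 < q := by linarith
  have h7 : 0 < 7 * r := by positivity
  set ω := volume (Metric.ball (0 : Eu) 1) with hω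
  have hω0 : ω ≠ 0 := (Metric.measure_ball_pos _ _ one_pos).ne'
  have hω1 : ω ≠ ∞ := measure_ball_lt_top.ne
  set α := (n : ℝ) - q * ((n : ℝ) - 1) with hα
  set m := μ (Metric.closedBall x (5 * r))
  set M := fracMaximal α μ y
  have hvol : volume (Metric.ball y (7 * r)) = ENNReal.ofReal ((7 * r) ^ α) *
      (ENNReal.ofReal ((7 * r) ^ (q * ((n : ℝ) - 1))) * ω) := by
    rw [Measure.addHaar_ball_of_pos _ _ h7, finrank_euclideanSpace_fin, ← mul_assoc,
      ← ENNReal.ofReal_mul (by positivity), ← Real.rpow_add h7, hα, sub_add_cancel,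
      Real.rpow_natCast]
  -- The closed ball of radius `5 r` about `x` lies within distance `6 r` of `y`; the radius `7 r`
  -- makes room for an open ball.
  have h1 : ENNReal.ofReal ((7 * r) ^ α) * (m / volume (Metric.ball y (7 * r))) ≤ M := by
    refine le_iSup₂_of_le (7 * r) h7 ?_
    gcongr ENNReal.ofReal ((7 * r) ^ α) * (μ ?_ / _)
    refine Metric.closedBall_subset_ball' ?_
    rw [Metric.mem_closedBall, dist_comm] at hy
    linarith
  have ha0 : ENNReal.ofReal ((7 * r) ^ α) ≠ 0 := by
    rw [ENNReal.ofReal_ne_zero_iff]; positivity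
  have hb0 : ENNReal.ofReal ((7 * r) ^ (q * ((n : ℝ) - 1))) ≠ 0 := by
    rw [ENNReal.ofReal_ne_zero_iff]; positivity
  rw [hvol, ← mul_div_assoc, ENNReal.mul_div_mul_left _ _ ha0 ENNReal.ofReal_ne_top,
    ENNReal.div_le_iff (mul_ne_zero hb0 hω0) (by finiteness)] at h1
  -- The right side is `ω + 1`, which makes the constant independent of `q`.
  have hωq : ω ^ (1 / q) ≤ (1 + ω⁻¹) * ω := by
    rw [add_mul, one_mul, ENNReal.inv_mul_cancel hω0 hω1]
    obtain h | h := le_total ω 1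
    · exact (ENNReal.rpow_le_one h (by positivity)).trans le_add_self
    · calc ω ^ (1 / q) ≤ ω ^ (1 : ℝ) :=
          ENNReal.rpow_le_rpow_of_exponent_le h ((div_le_one hq0).2 hq)
        _ = ω := ENNReal.rpow_one ω
        _ ≤ ω + 1 := le_self_add
  have hbq : (ENNReal.ofReal ((7 * r) ^ (q * ((n : ℝ) - 1)))) ^ (1 / q) =
      ENNReal.ofReal ((7 * r) ^ ((n : ℝ) - 1)) := by
    rw [ENNReal.ofReal_rpow_of_nonneg (by positivity) (by positivity), ← Real.rpow_mul h7.le]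
    congr 2
    field_simp
  have hr0 : ENNReal.ofReal r ≠ 0 := by rwa [ENNReal.ofReal_ne_zero_iff]
  have hcancel : ENNReal.ofReal ((7 * r) ^ ((n : ℝ) - 1)) * ω ≤ 7 ^ n * 2 ^ (2 * n + 4) * G := by
    refine (ENNReal.mul_le_mul_iff_left hr0 ENNReal.ofReal_ne_top).1 ?_
    calc ENNReal.ofReal ((7 * r) ^ ((n : ℝ) - 1)) * ω * ENNReal.ofReal r
        ≤ ENNReal.ofReal ((7 * r) ^ ((n : ℝ) - 1)) * ω * ENNReal.ofReal (7 * r) := by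
          gcongr; linarith
      _ = ENNReal.ofReal ((7 * r) ^ n) * ω := by
          rw [mul_right_comm, ← ENNReal.ofReal_mul (by positivity)]
          nth_rw 2 [← Real.rpow_one (7 * r)]
          rw [← Real.rpow_add h7, sub_add_cancel, Real.rpow_natCast]
      _ = 7 ^ n * volume (Metric.ball x r) := by
          rw [Measure.addHaar_ball_of_pos _ _ hr, finrank_euclideanSpace_fin, mul_pow,
            ENNReal.ofReal_mul (by positivity), ENNReal.ofReal_pow (by norm_num),
            ENNReal.ofReal_ofNat, mul_assoc]
      _ ≤ 7 ^ n * (2 ^ (2 * n + 4) * ENNReal.ofReal r * G) := by gcongr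
      _ = _ := by ring
  calc m ^ (1 / q) ≤ (M * (ENNReal.ofReal ((7 * r) ^ (q * ((n : ℝ) - 1))) * ω)) ^ (1 / q) := by
        gcongr
    _ = ω ^ (1 / q) * ENNReal.ofReal ((7 * r) ^ ((n : ℝ) - 1)) * M ^ (1 / q) := by
        rw [ENNReal.mul_rpow_of_nonneg _ _ (by positivity),
          ENNReal.mul_rpow_of_nonneg _ _ (by positivity), hbq]
        ring
    _ ≤ (1 + ω⁻¹) * ω * ENNReal.ofReal ((7 * r) ^ ((n : ℝ) - 1)) * M ^ (1 / q) := by gcongr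
    _ = (1 + ω⁻¹) * (ENNReal.ofReal ((7 * r) ^ ((n : ℝ) - 1)) * ω) * M ^ (1 / q) := by ring
    _ ≤ (1 + ω⁻¹) * (7 ^ n * 2 ^ (2 * n + 4) * G) * M ^ (1 / q) := by gcongr
    _ = _ := by rw [ballConstant]; ring

theorem rpow_measure_closedBall_le_setLIntegral {q : ℝ} (hq : 1 ≤ q) (μ : Measure Eu) {x : Eu}
    {r : ℝ} (hr : 0 < r) {w : Eu → ℝ} {K : ℝ≥0} (hw : LipschitzWith K w)
    (hG : volume (Metric.ball x r) ≤
      2 ^ (2 * n + 4) * ENNReal.ofReal r * ∫⁻ y in Metric.ball x r, ‖fderiv ℝ w y‖ₑ) :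
    μ (Metric.closedBall x (5 * r)) ^ (1 / q) ≤
      ballConstant n * ∫⁻ y in Metric.closedBall x r, ‖fderiv ℝ w y‖ₑ *
        fracMaximal ((n : ℝ) - q * ((n : ℝ) - 1)) μ y ^ (1 / q) := by
  have hsub := lintegral_mono_set (μ := volume) (f := fun y => ‖fderiv ℝ w y‖ₑ)
    (Metric.ball_subset_closedBall (x := x) (ε := r))
  have hG' := hG.trans (mul_le_mul_right hsub _)
  have hpos : 0 < volume (Metric.ball x r) := Metric.measure_ball_pos _ _ hr
  set G := ∫⁻ y in Metric.closedBall x r, ‖fderiv ℝ w y‖ₑ with hGdef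
  have hG0 : G ≠ 0 := fun h => by simp [h] at hG'; simp [hG'] at hpos
  have hG1 : G ≠ ∞ := by
    have : G ≤ K * volume (Metric.closedBall x r) := by
      rw [← setLIntegral_const]
      refine lintegral_mono fun y => ?_
      rw [← ofReal_norm, ← ENNReal.ofReal_coe_nnreal]
      exact ENNReal.ofReal_le_ofReal (norm_fderiv_le_of_lipschitz ℝ hw)
    exact ne_top_of_le_ne_top
      (ENNReal.mul_ne_top ENNReal.coe_ne_top measure_closedBall_lt_top.ne) this
  -- The pointwise bound holds for every `y` in the ball; it is averaged against the weight `‖fderiv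
  -- ℝ w y‖ₑ`, whose total mass `G` is positive and finite.
  refine (ENNReal.mul_le_mul_iff_left hG0 hG1).1 ?_
  rw [hGdef, ← lintegral_const_mul _ (measurable_fderiv ℝ w).enorm, ← hGdef, mul_right_comm,
    ← lintegral_const_mul' _ _ (ENNReal.mul_ne_top (ballConstant_ne_top n) hG1)]
  refine setLIntegral_mono' measurableSet_closedBall fun y hy => ?_
  rw [mul_left_comm, mul_comm]
  gcongr
  exact rpow_measure_closedBall_le hq μ hr hy hG'

/-- Boxing inequality at one level. The gap `δ` only provides the initial radius `ρ`, and `h` only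
has to be small relative to `ρ`; neither enters the constant. -/
theorem rpow_measure_le_lintegral_fderiv_levelTruncation (hn : 2 ≤ n) {q : ℝ} (hq : 1 ≤ q)
    (μ : Measure Eu) {u : Eu → ℝ} {K : ℝ≥0} (hu : LipschitzWith K u) {t δ h ρ : ℝ}
    (hρ : 0 < ρ) (hKρ : K * ρ ≤ δ) (hh : 0 < h)
    (hA : volume {x | t < |u x|} ≠ ∞)
    (hZ : 2 ^ (n + 2) * volume {x | t < |u x| ∧ |u x| < t + h} ≤
      volume (Metric.ball (0 : Eu) ρ)) :
    μ {x | t + δ < |u x|} ^ (1 / q) ≤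
      ballConstant n * ∫⁻ y, ‖fderiv ℝ (levelTruncation u t h) y‖ₑ *
        fracMaximal ((n : ℝ) - q * ((n : ℝ) - 1)) μ y ^ (1 / q) := by
  have hfin : Module.finrank ℝ Eu = n := finrank_euclideanSpace_fin
  have : Nontrivial Eu := Module.nontrivial_of_finrank_pos (R := ℝ) (by omega)
  have : NoncompactSpace Eu := NormedSpace.noncompactSpace ℝ Eu
  -- The superlevel set has finite volume while the balls exhaust a space of infinite volume, so one
  -- `N` serves all centres.
  obtain ⟨N, hN⟩ : ∃ N : ℕ, 2 * volume {x | t < |u x|} ≤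
      volume (Metric.ball (0 : Eu) (2 ^ N * ρ)) := by
    have hU : ⋃ N : ℕ, Metric.ball (0 : Eu) (2 ^ N * ρ) = Set.univ := by
      refine Set.eq_univ_of_forall fun y => Set.mem_iUnion.2 ?_
      obtain ⟨N, hN⟩ := pow_unbounded_of_one_lt (‖y‖ / ρ) one_lt_two
      exact ⟨N, by rwa [mem_ball_zero_iff, ← div_lt_iff₀ hρ]⟩
    have hmono : Monotone fun N : ℕ => Metric.ball (0 : Eu) (2 ^ N * ρ) := fun i j hij =>
      Metric.ball_subset_ball (by gcongr; exact one_le_two)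
    have hlt : 2 * volume {x | t < |u x|} <
        ⨆ N : ℕ, volume (Metric.ball (0 : Eu) (2 ^ N * ρ)) := by
      rw [← hmono.measure_iUnion, hU, measure_univ_of_isAddLeftInvariant]
      exact (ENNReal.mul_ne_top (by simp) hA).lt_top
    obtain ⟨N, hN⟩ := lt_iSup_iff.1 hlt
    exact ⟨N, hN.le⟩
  have hex : ∀ x : Eu, ∃ r, x ∈ {x | t + δ < |u x|} → ρ ≤ r ∧ r ≤ 2 ^ N * ρ ∧
      volume (Metric.ball x r) ≤ 2 ^ (2 * n + 4) * ENNReal.ofReal r *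
        ∫⁻ y in Metric.ball x r, ‖fderiv ℝ (levelTruncation u t h) y‖ₑ := fun x => by
    by_cases hx : x ∈ {x | t + δ < |u x|}
    swap
    · exact ⟨0, fun h => absurd h hx⟩
    have hball : Metric.ball x ρ ⊆ {x | t < |u x|} := fun y hy => by
      have h1 := hu.dist_le_mul x y
      rw [Real.dist_eq] at h1
      have h2 : (K : ℝ) * dist x y ≤ K * ρ := by
        gcongr; rw [dist_comm]; exact (Metric.mem_ball.1 hy).le
      have h3 := abs_sub_abs_le_abs_sub (u x) (u y)
      simp only [Set.mem_ofPred_eq] at hx ⊢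
      linarith
    obtain ⟨r, hr1, hr2, hr3, hr4⟩ := exists_radius_measure_inter_ball hρ hN hball
    refine ⟨r, fun _ => ⟨hr1, hr2, ?_⟩⟩
    have := measure_ball_le_lintegral_fderiv_levelTruncation (μ := volume) hu hh (hρ.trans_le hr1)
      (by
        rw [hfin]
        refine hZ.trans ?_
        rw [← Measure.addHaar_ball_center volume x ρ]
        exact measure_mono (Metric.ball_subset_ball hr1)) hr3 hr4
    rwa [hfin] at this
  choose r hr using hex
  obtain ⟨s, hs, hdisj, hcov⟩ := Vitali.exists_disjoint_subfamily_covering_enlargement_closedBall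
    {x : Eu | t + δ < |u x|} id r (2 ^ N * ρ) (fun x hx => (hr x hx).2.1) 5 (by norm_num)
  have hrpos : ∀ x ∈ s, 0 < r x := fun x hx => hρ.trans_le (hr x (hs hx)).1
  -- Countability is needed both for subadditivity of `μ` over the enlarged balls and for additivity
  -- of the integral over the disjoint ones.
  have hcount : s.Countable := hdisj.countable_of_nonempty_interior fun x hx =>
    ⟨x, Metric.ball_subset_interior_closedBall (Metric.mem_ball_self (hrpos x hx))⟩
  have := hcount.to_subtype
  obtain ⟨K', hK'⟩ := hu.levelTruncation t h
  set F : Eu → ℝ≥0∞ := fun y => ‖fderiv ℝ (levelTruncation u t h) y‖ₑ *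
        fracMaximal ((n : ℝ) - q * ((n : ℝ) - 1)) μ y ^ (1 / q) with hF
  have hsub : {x | t + δ < |u x|} ⊆ ⋃ i : s, Metric.closedBall (i : Eu) (5 * r i) := fun x hx => by
    obtain ⟨b, hb, hxb⟩ := hcov x hx
    exact Set.mem_iUnion.2 ⟨⟨b, hb⟩,
      hxb (Metric.mem_closedBall_self (hρ.le.trans (hr x hx).1))⟩
  calc μ {x | t + δ < |u x|} ^ (1 / q)
      ≤ (∑' i : s, μ (Metric.closedBall (i : Eu) (5 * r i))) ^ (1 / q) := by
        gcongr; exact (measure_mono hsub).trans (measure_iUnion_le _)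
    _ ≤ ∑' i : s, μ (Metric.closedBall (i : Eu) (5 * r i)) ^ (1 / q) :=
        ENNReal.tsum_rpow_le_tsum_rpow _ hq
    _ ≤ ∑' i : s, ballConstant n * ∫⁻ y in Metric.closedBall (i : Eu) (r i), F y :=
        ENNReal.tsum_le_tsum fun i => rpow_measure_closedBall_le_setLIntegral hq μ
          (hrpos i i.2) hK' (hr i (hs i.2)).2.2
    _ = ballConstant n * ∫⁻ y in ⋃ i : s, Metric.closedBall (i : Eu) (r i), F y := by
        rw [ENNReal.tsum_mul_left, lintegral_iUnion (fun _ => measurableSet_closedBall)]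
        intro i j hij
        exact hdisj i.2 j.2 (fun e => hij (Subtype.ext e))
    _ ≤ _ := by gcongr; exact Measure.restrict_le_self

end Maximal

/-! ### Limits in the strip width, integration over levels, and the Lorentz norm -/

section Lorentz

variable {n : ℕ}

local notation "Eu" => EuclideanSpace ℝ (Fin n)

theorem enorm_gradient (u : Eu → ℝ) (x : Eu) : ‖gradient u x‖ₑ = ‖fderiv ℝ u x‖ₑ := by
  rw [← ofReal_norm, ← ofReal_norm, gradient, LinearIsometryEquiv.norm_map]

theorem lintegral_fderiv_levelTruncation_mul_le {u : Eu → ℝ} (hu : Continuous u) {t h : ℝ}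
    (ht : 0 ≤ t) (hh : 0 < h) (W : Eu → ℝ≥0∞) :
    ∫⁻ y, ‖fderiv ℝ (levelTruncation u t h) y‖ₑ * W y ≤ ENNReal.ofReal h⁻¹ *
      ∫⁻ y, {x | t < |u x| ∧ |u x| < t + h}.indicator (fun x => ‖gradient u x‖ₑ * W x) y := by
  rw [← lintegral_const_mul' _ _ ENNReal.ofReal_ne_top]
  refine lintegral_mono fun y => ?_
  refine (mul_le_mul_left (enorm_fderiv_levelTruncation_le hu ht hh y) _).trans_eq ?_
  by_cases hy : y ∈ {x | t < |u x| ∧ |u x| < t + h}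
  · simp only [Set.indicator_of_mem hy, enorm_gradient, mul_assoc]
  · simp only [Set.indicator_of_notMem hy, zero_mul, mul_zero]

/-- The lower inequality is strict, so the strips decrease to the empty set whatever the measure of
the level set `f = t`. -/
theorem tendsto_measure_level_strip {X : Type*} [MeasurableSpace X] {ν : Measure X} {f : X → ℝ}
    (hf : Measurable f) {t : ℝ} (hfin : ν {x | t < f x} ≠ ∞) :
    Filter.Tendsto (fun k : ℕ => ν {x | t < f x ∧ f x < t + 1 / ((k : ℝ) + 1)}) Filter.atTop
      (nhds 0) := by
  have hI : ⋂ k : ℕ, {x | t < f x ∧ f x < t + 1 / ((k : ℝ) + 1)} = ∅ := by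
    refine Set.eq_empty_of_forall_notMem fun x hx => ?_
    have hx' := fun k : ℕ => Set.mem_iInter.1 hx k
    obtain ⟨k, hk⟩ := exists_nat_one_div_lt (sub_pos.2 (hx' 0).1)
    have := (hx' k).2
    linarith
  rw [← measure_empty (μ := ν), ← hI]
  refine tendsto_measure_iInter_atTop (fun k => ?_) (fun i j hij x hx => ⟨hx.1, hx.2.trans_le ?_⟩)
    ⟨0, measure_ne_top_of_subset (fun x hx => hx.1) hfin⟩
  · exact ((measurableSet_lt measurable_const hf).inter
      (measurableSet_lt hf measurable_const)).nullMeasurableSet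
  · gcongr

/-- For fixed `δ` the strip is thin enough for all large `k`, so the one-level bound holds
eventually. The right side does not involve `δ`, which then tends to 0 along `1 / (j + 1)`. -/
theorem rpow_measure_superlevel_le_liminf (hn : 2 ≤ n) {q : ℝ} (hq : 1 ≤ q)
    (μ : Measure Eu) {u : Eu → ℝ} {K : ℝ≥0} (hu : LipschitzWith K u) (hc : HasCompactSupport u)
    {t : ℝ} (ht : 0 ≤ t) :
    μ {x | t < |u x|} ^ (1 / q) ≤ Filter.liminf (fun k : ℕ =>
      ballConstant n * (ENNReal.ofReal ((k : ℝ) + 1) *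
        ∫⁻ y, {x | t < |u x| ∧ |u x| < t + 1 / ((k : ℝ) + 1)}.indicator
          (fun x => ‖gradient u x‖ₑ *
            fracMaximal ((n : ℝ) - q * ((n : ℝ) - 1)) μ x ^ (1 / q)) y)) Filter.atTop := by
  have hq0 : 0 < q := by linarith
  have hA : volume {x | t < |u x|} ≠ ∞ := by
    refine measure_ne_top_of_subset (fun x hx => subset_tsupport u ?_) hc.measure_lt_top.ne
    exact abs_pos.1 (ht.trans_lt hx)
  have hU : {x | t < |u x|} = ⋃ j : ℕ, {x | t + 1 / ((j : ℝ) + 1) < |u x|} := by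
    ext x
    simp only [Set.mem_ofPred_eq, Set.mem_iUnion]
    constructor
    · intro hx
      obtain ⟨k, hk⟩ := exists_nat_one_div_lt (sub_pos.2 hx)
      exact ⟨k, by linarith⟩
    · rintro ⟨k, hk⟩
      have : 0 < 1 / ((k : ℝ) + 1) := by positivity
      linarith
  have hmono : Monotone fun j : ℕ => {x | t + 1 / ((j : ℝ) + 1) < |u x|} := fun i j hij x hx => by
    have := Nat.one_div_le_one_div (α := ℝ) hij
    simp only [Set.mem_ofPred_eq] at hx ⊢
    linarith
  rw [hU, hmono.measure_iUnion, one_div, ENNReal.rpow_inv_le_iff hq0]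
  refine iSup_le fun j => ?_
  rw [← ENNReal.rpow_inv_le_iff hq0, ← one_div]
  refine Filter.le_liminf_of_le (by isBoundedDefault) ?_
  have hj : 0 < 1 / ((j : ℝ) + 1) := by positivity
  set δ := 1 / ((j : ℝ) + 1)
  -- The denominator `K + 1` covers `K = 0`.
  have hρ : 0 < δ / ((K : ℝ) + 1) := by positivity
  have hKρ : K * (δ / ((K : ℝ) + 1)) ≤ δ := by
    rw [mul_div_assoc', div_le_iff₀ (by positivity)]; linarith
  have hlim := ENNReal.Tendsto.const_mul (a := 2 ^ (n + 2))
    (tendsto_measure_level_strip hu.continuous.abs.measurable hA) (Or.inr (by finiteness))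
  rw [mul_zero] at hlim
  filter_upwards [hlim.eventually (ge_mem_nhds (Metric.measure_ball_pos volume (0 : Eu) hρ))]
    with k hk
  have hh : 0 < 1 / ((k : ℝ) + 1) := by positivity
  refine (rpow_measure_le_lintegral_fderiv_levelTruncation hn hq μ hu hρ hKρ hh hA hk).trans ?_
  gcongr
  refine (lintegral_fderiv_levelTruncation_mul_le hu.continuous ht hh _).trans_eq ?_
  rw [one_div, inv_inv]

/-- A layer-cake estimate: averaging the strips `t < f < t + h` over `t`. -/
theorem lintegral_lintegral_strip_le {X : Type*} [MeasurableSpace X] {ν : Measure X} [SFinite ν]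
    {f : X → ℝ} (hf : Measurable f) {W : X → ℝ≥0∞} (hW : Measurable W) {h : ℝ} (hh : 0 < h)
    (κ : Measure ℝ) [SFinite κ] (hκ : κ ≤ volume) :
    ∫⁻ t, (ENNReal.ofReal h⁻¹ * ∫⁻ x, {x | t < f x ∧ f x < t + h}.indicator W x ∂ν) ∂κ ≤
      ∫⁻ x, W x ∂ν := by
  have hS : MeasurableSet {p : ℝ × X | p.1 < f p.2 ∧ f p.2 < p.1 + h} :=
    (measurableSet_lt measurable_fst (hf.comp measurable_snd)).inter
      (measurableSet_lt (hf.comp measurable_snd) (measurable_fst.add_const h))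
  have hm : Measurable (Function.uncurry
      fun t x => {x | t < f x ∧ f x < t + h}.indicator W x) :=
    (hW.comp measurable_snd).indicator hS
  rw [lintegral_const_mul' _ _ ENNReal.ofReal_ne_top, lintegral_lintegral_swap hm.aemeasurable,
    ← lintegral_const_mul' _ _ ENNReal.ofReal_ne_top]
  refine lintegral_mono fun x => ?_
  -- For fixed `x` the admissible levels form an interval of length `h`, which cancels `h⁻¹`.
  have h1 : ∀ t, {x | t < f x ∧ f x < t + h}.indicator W x =
      (Set.Ioo (f x - h) (f x)).indicator (fun _ => W x) t := fun t => by
    by_cases hx : t < f x ∧ f x < t + h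
    · rw [Set.indicator_of_mem (s := {x | t < f x ∧ f x < t + h}) hx,
        Set.indicator_of_mem (Set.mem_Ioo.2 ⟨by linarith [hx.2], hx.1⟩)]
    · rw [Set.indicator_of_notMem (s := {x | t < f x ∧ f x < t + h}) hx,
        Set.indicator_of_notMem fun hx' => hx ⟨hx'.2, by linarith [hx'.1]⟩]
  simp_rw [h1]
  rw [lintegral_indicator_const measurableSet_Ioo]
  calc ENNReal.ofReal h⁻¹ * (W x * κ (Set.Ioo (f x - h) (f x)))
      ≤ ENNReal.ofReal h⁻¹ * (W x * volume (Set.Ioo (f x - h) (f x))) := by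
        gcongr
    _ = W x := by
        rw [Real.volume_Ioo, sub_sub_cancel, mul_left_comm, ← ENNReal.ofReal_mul (by positivity),
          inv_mul_cancel₀ hh.ne', ENNReal.ofReal_one, mul_one]

/-- Fatou's lemma moves the liminf outside the integral over `t`, where the layer-cake estimate
bounds every term by the same quantity. This plays the role of the coarea formula. -/
theorem lintegral_rpow_measure_superlevel_le (hn : 2 ≤ n) {q : ℝ} (hq : 1 ≤ q)
    (μ : Measure Eu) {u : Eu → ℝ} {K : ℝ≥0} (hu : LipschitzWith K u)
    (hc : HasCompactSupport u) :
    ∫⁻ t in Set.Ioi (0 : ℝ), μ {x | t < |u x|} ^ (1 / q) ≤ ballConstant n *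
      ∫⁻ x, ‖gradient u x‖ₑ * fracMaximal ((n : ℝ) - q * ((n : ℝ) - 1)) μ x ^ (1 / q) := by
  set W : Eu → ℝ≥0∞ := fun x => ‖gradient u x‖ₑ *
    fracMaximal ((n : ℝ) - q * ((n : ℝ) - 1)) μ x ^ (1 / q)
  have hW : Measurable W := by
    refine Measurable.mul ?_ ((lowerSemicontinuous_fracMaximal _ μ).measurable.pow_const _)
    simp_rw [enorm_gradient]
    exact (measurable_fderiv ℝ u).enorm
  have hf : Measurable fun x => |u x| := hu.continuous.abs.measurable
  have hm : ∀ h : ℝ, Measurable fun t =>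
      ∫⁻ x, {x | t < |u x| ∧ |u x| < t + h}.indicator W x := fun h => by
    have hS : MeasurableSet {p : ℝ × Eu | p.1 < |u p.2| ∧ |u p.2| < p.1 + h} :=
      (measurableSet_lt (by fun_prop) (hf.comp measurable_snd)).inter
        (measurableSet_lt (hf.comp measurable_snd) (by fun_prop))
    exact Measurable.lintegral_prod_right' (f := fun p : ℝ × Eu =>
      {x | p.1 < |u x| ∧ |u x| < p.1 + h}.indicator W p.2)
      ((hW.comp measurable_snd).indicator hS)
  calc ∫⁻ t in Set.Ioi (0 : ℝ), μ {x | t < |u x|} ^ (1 / q)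
      ≤ ∫⁻ t in Set.Ioi (0 : ℝ), Filter.liminf (fun k : ℕ =>
          ballConstant n * (ENNReal.ofReal ((k : ℝ) + 1) *
          ∫⁻ y, {x | t < |u x| ∧ |u x| < t + 1 / ((k : ℝ) + 1)}.indicator W y)) Filter.atTop :=
        setLIntegral_mono' measurableSet_Ioi fun t ht =>
          rpow_measure_superlevel_le_liminf hn hq μ hu hc (le_of_lt ht)
    _ ≤ Filter.liminf (fun k : ℕ => ∫⁻ t in Set.Ioi (0 : ℝ),
          ballConstant n * (ENNReal.ofReal ((k : ℝ) + 1) *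
          ∫⁻ y, {x | t < |u x| ∧ |u x| < t + 1 / ((k : ℝ) + 1)}.indicator W y)) Filter.atTop :=
        lintegral_liminf_le fun k => ((hm _).const_mul _).const_mul _
    _ ≤ Filter.liminf (fun _ : ℕ => ballConstant n * ∫⁻ x, W x) Filter.atTop := by
        refine Filter.liminf_le_liminf (Filter.Eventually.of_forall fun k => ?_)
        rw [lintegral_const_mul' _ _ (ballConstant_ne_top n)]
        gcongr
        have hh : 0 < 1 / ((k : ℝ) + 1) := by positivity
        have := lintegral_lintegral_strip_le (ν := volume) hf hW hh
          (volume.restrict (Set.Ioi 0)) Measure.restrict_le_self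
        rwa [one_div, inv_inv, ← one_div] at this
    _ = _ := Filter.liminf_const _

theorem eLorentzNorm_one_eq {X : Type*} [MeasurableSpace X] (f : X → ℝ) (q : ℝ) (μ : Measure X) :
    eLorentzNorm f q 1 μ =
      ENNReal.ofReal q * ∫⁻ t in Set.Ioi (0 : ℝ), μ {x | t < |f x|} ^ (1 / q) := by
  simp [eLorentzNorm]

/-- With `m(t) = μ {|f| > t}`, monotonicity gives `t m(t) ^ (1/q) ≤ N`. Writing `t ^ (q - 1) m = (t
m ^ (1/q)) ^ (q - 1) m ^ (1/q)` in the layer-cake formula bounds the integral of `|f| ^ q` by `q N ^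
q`. -/
theorem eLpNorm_le_eLorentzNorm_one {X : Type*} [MeasurableSpace X] {μ : Measure X} {f : X → ℝ}
    (hf : AEMeasurable f μ) {q : ℝ} (hq : 1 ≤ q) :
    eLpNorm f (ENNReal.ofReal q) μ ≤ eLorentzNorm f q 1 μ := by
  have hq0 : 0 < q := by linarith
  rw [eLorentzNorm_one_eq, eLpNorm_eq_lintegral_rpow_enorm_toReal (by simpa using hq0)
    ENNReal.ofReal_ne_top, ENNReal.toReal_ofReal hq0.le]
  set N := ∫⁻ t in Set.Ioi (0 : ℝ), μ {x | t < |f x|} ^ (1 / q) with hN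
  have hNt : ∀ t : ℝ, 0 < t → ENNReal.ofReal t * μ {x | t < |f x|} ^ (1 / q) ≤ N := fun t ht =>
    calc ENNReal.ofReal t * μ {x | t < |f x|} ^ (1 / q)
        = ∫⁻ s in Set.Ioo 0 t, μ {x | t < |f x|} ^ (1 / q) := by
          rw [setLIntegral_const, Real.volume_Ioo, sub_zero, mul_comm]
      _ ≤ ∫⁻ s in Set.Ioo 0 t, μ {x | s < |f x|} ^ (1 / q) := by
          refine setLIntegral_mono' measurableSet_Ioo fun s hs => ?_
          gcongr with x
          exact hs.2.le
      _ ≤ N := lintegral_mono_set Set.Ioo_subset_Ioi_self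
  have hlc : ∫⁻ x, ‖f x‖ₑ ^ q ∂μ = ENNReal.ofReal q *
      ∫⁻ t in Set.Ioi (0 : ℝ), μ {x | t < |f x|} * ENNReal.ofReal (t ^ (q - 1)) := by
    rw [← lintegral_rpow_eq_lintegral_meas_lt_mul μ (Filter.Eventually.of_forall
      fun x => abs_nonneg (f x)) (by simpa using hf.norm) hq0]
    refine lintegral_congr fun x => ?_
    rw [← ofReal_norm, Real.norm_eq_abs, ENNReal.ofReal_rpow_of_nonneg (abs_nonneg _) hq0.le]
  have hpt : ∀ t : ℝ, 0 < t → μ {x | t < |f x|} * ENNReal.ofReal (t ^ (q - 1)) ≤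
      N ^ (q - 1) * μ {x | t < |f x|} ^ (1 / q) := fun t ht => by
    set m := μ {x | t < |f x|}
    have hm : m = (m ^ (1 / q)) ^ (q - 1) * m ^ (1 / q) := by
      have h1 : m ^ (1 / q) = (m ^ (1 / q)) ^ (1 : ℝ) := (ENNReal.rpow_one _).symm
      nth_rw 2 [h1]
      rw [← ENNReal.rpow_add_of_nonneg _ _ (by linarith) zero_le_one, sub_add_cancel,
        ← ENNReal.rpow_mul, one_div, inv_mul_cancel₀ hq0.ne', ENNReal.rpow_one]
    calc m * ENNReal.ofReal (t ^ (q - 1))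
        = (ENNReal.ofReal t * m ^ (1 / q)) ^ (q - 1) * m ^ (1 / q) := by
          rw [ENNReal.mul_rpow_of_nonneg _ _ (by linarith),
            ENNReal.ofReal_rpow_of_nonneg ht.le (by linarith), mul_assoc, ← hm, mul_comm]
      _ ≤ _ := by
          gcongr
          exact hNt t ht
  have hNq : N ^ (q - 1) * N = N ^ q := by
    nth_rw 2 [← ENNReal.rpow_one N]
    rw [← ENNReal.rpow_add_of_nonneg _ _ (by linarith) zero_le_one, sub_add_cancel]
  have hanti : Antitone fun t : ℝ => μ {x | t < |f x|} ^ (1 / q) := fun s t hst => by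
    dsimp only
    gcongr
  rw [one_div, ENNReal.rpow_inv_le_iff hq0, hlc, ENNReal.mul_rpow_of_nonneg _ _ hq0.le]
  -- It remains to compare `q N ^ q` with `(q N) ^ q`, and `q ≤ q ^ q` because `q ≥ 1`.
  gcongr ?_ * ?_
  · rw [ENNReal.ofReal_rpow_of_pos hq0]
    exact ENNReal.ofReal_le_ofReal (Real.self_le_rpow_of_one_le hq hq)
  · rw [← hNq, hN, ← lintegral_const_mul _ hanti.measurable]
    exact setLIntegral_mono' measurableSet_Ioi hpt

end Lorentz

theorem mainTheorem9 (n : ℕ) (hn : 2 ≤ n) :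
    ∃ C : ℝ≥0,
      (∀ q : ℝ, 1 ≤ q → q ≤ (n : ℝ) / ((n : ℝ) - 1) →
        ∀ (μ : Measure (EuclideanSpace ℝ (Fin n))) [IsLocallyFiniteMeasure μ]
          (u : EuclideanSpace ℝ (Fin n) → ℝ),
          (∃ K : ℝ≥0, LipschitzWith K u) → HasCompactSupport u →
          eLorentzNorm u q 1 μ ≤
            C * ∫⁻ x, ‖gradient u x‖ₑ *
              fracMaximal ((n : ℝ) - q * ((n : ℝ) - 1)) μ x ^ (1 / q)) ∧
      (∀ (μ : Measure (EuclideanSpace ℝ (Fin n))) [IsLocallyFiniteMeasure μ]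
          (u : EuclideanSpace ℝ (Fin n) → ℝ),
          (∃ K : ℝ≥0, LipschitzWith K u) → HasCompactSupport u →
          eLpNorm u (ENNReal.ofReal ((n : ℝ) / ((n : ℝ) - 1))) μ ≤
            eLorentzNorm u ((n : ℝ) / ((n : ℝ) - 1)) 1 μ ∧
          eLorentzNorm u ((n : ℝ) / ((n : ℝ) - 1)) 1 μ ≤
            C * ∫⁻ x, ‖gradient u x‖ₑ * hlMaximal μ x ^ (((n : ℝ) - 1) / (n : ℝ))) := by
  have hn' : (2 : ℝ) ≤ n := by exact_mod_cast hn
  have hn1 : (0 : ℝ) < (n : ℝ) - 1 := by linarith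
  have hle2 : (n : ℝ) / ((n : ℝ) - 1) ≤ 2 := by
    rw [div_le_iff₀ hn1]; linarith
  have h1le : 1 ≤ (n : ℝ) / ((n : ℝ) - 1) := by
    rw [le_div_iff₀ hn1]; linarith
  -- The factor `q` in the Lorentz norm is at most `n / (n - 1) ≤ 2`, which gives the constant `2 *
  -- ballConstant n` for all `q` at once.
  have key : ∀ q : ℝ, 1 ≤ q → q ≤ (n : ℝ) / ((n : ℝ) - 1) →
      ∀ (μ : Measure (EuclideanSpace ℝ (Fin n))) (u : EuclideanSpace ℝ (Fin n) → ℝ),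
        (∃ K : ℝ≥0, LipschitzWith K u) → HasCompactSupport u →
        eLorentzNorm u q 1 μ ≤ (2 * ballConstant n).toNNReal * ∫⁻ x, ‖gradient u x‖ₑ *
          fracMaximal ((n : ℝ) - q * ((n : ℝ) - 1)) μ x ^ (1 / q) := by
    rintro q hq hqn μ u ⟨K, hu⟩ hc
    rw [eLorentzNorm_one_eq, ENNReal.coe_toNNReal
      (ENNReal.mul_ne_top ENNReal.ofNat_ne_top (ballConstant_ne_top n)), mul_assoc]
    gcongr
    · rw [← ENNReal.ofReal_ofNat]
      exact ENNReal.ofReal_le_ofReal (hqn.trans hle2)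
    · exact lintegral_rpow_measure_superlevel_le hn hq μ hu hc
  refine ⟨_, fun q hq hqn μ _ u hu hc => key q hq hqn μ u hu hc, fun μ _ u hu hc => ⟨?_, ?_⟩⟩
  · exact eLpNorm_le_eLorentzNorm_one hu.choose_spec.continuous.aemeasurable h1le
  · have h := key _ h1le le_rfl μ u hu hc
    -- At `q = n / (n - 1)` the order `α = n - q (n - 1)` is 0.
    rw [div_mul_cancel₀ _ hn1.ne', sub_self, one_div_div] at h
    simpa only [fracMaximal_zero] using h
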